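/- Conventions. An inverse monoid $S$ is $X$-generated via a map $\iota_S\colon X\to S$ (not necessarily injective) if it is generated by $\iota_S(X)$ in the signature $(\cdot,1,{}^{-1})$; for a word $w\in(X\cup X^{-1})^*$, $w_S$ denotes its value in $S$. A homomorphism between $X$-generated structures is canonical if it respects the maps from $X$. Let $\sigma$ be the least group congruence of $S$; $S$ is $E$-unitary if the $\sigma$-class of $1$ is the set of idempotents of $S$. The greatest group image $G=S/\sigma$ is $X$-generated via the composite $X\to S\to G$. The Cayley graph of an $X$-generated inverse monoid (or group) $M$ has vertex set $M$ and an edge labelled $x$ from $m$ to $m x_M$ for all $m\in M$, $x\in X\cup X^{-1}$. Let $\Gamma_X$ be the Cayley graph of the group $G$ and $\operatorname{CSub}\Gamma_X$ the poset, under inclusion, of its connected (in particular non-empty) subgraphs, where subgraphs are closed under end points and inverses of edges. For an $E$-unitary $S$, the Schützenberger graph $S\Gamma(s)$, i.e. the strong component of $s$ in the Cayley graph of $S$, is viewed as a subgraph of $\Gamma_X$ via $t\mapsto t\sigma$. A closure operator $()^c$ on $\operatorname{CSub}\Gamma_X$ is $G$-invariant if $(g\Delta)^c=g(\Delta^c)$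 for all $g\in G$ and all $\Delta$, and finitary if $\Delta^c=\bigcup\{F^c: F\subseteq\Delta \text{ finite connected}\}$ for all $\Delta$; a subgraph is compact if it is of the form $F^c$ with $F$ finite and connected. For an $X$-generated $E$-unitary inverse monoid $S$ with greatest group image $G$, let $()^{c_S}$ be the ($G$-invariant) closure operator on $\operatorname{CSub}\Gamma_X$ whose closed elements are those $\Delta$ such that, for all words $u,v$ with $u_S=v_S$ and all vertices $g,h$ of $\Delta$, $u$ labels a path from $g$ to $h$ in $\Delta$ if and only if $v$ does. For an $X$-generated group $G$ and a $G$-invariant closure operator $()^c$ on $\operatorname{CSub}\Gamma_X$, let $S_c$ be the inverse monoid of all pairs $(\Delta,g)$ with $g\in G$ and $\Delta\in\operatorname{CSub}\Gamma_X$ compact and containing $1$ and $g$, with operations $(\Delta,g)(\Xi,h)=((\Delta\cup g\Xi)^c,gh)$ and $(\Delta,g)^{-1}=(g^{-1}\Delta,g^{-1})$, together with the map $X\to S_c$, $x\mapsto(\langle\overline x\rangle^c,x_G)$, where $\langle\overline x\rangle$ is the subgraph spanned by the edge labelled $x$ starting at $1$. Proposition. (1) For any $X$-generated $E$-unitary inverse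 monoid $S$ with greatest group image $G$, the map $\psi\colon S\to S_{c_S}$, $s\mapsto(S\Gamma(s),s\sigma)$, is a (well-defined) canonical isomorphism. (2) For any $X$-generated group $G$ and any $G$-invariant, finitary closure operator $()^c$ on $\operatorname{CSub}\Gamma_X$, the inverse monoid $S_c$ is $X$-generated and $E$-unitary with greatest group image $G$ (via $(\Delta,g)\mapsto g$), and $()^c=()^{c_{S_c}}$. -/

import Mathlib

/-- An inverse monoid: every `a` has exactly one inverse, written `a⁻¹`, i.e. exactly one `b` with
`a * b * a = a` and `b * a * b = b`. -/
class InverseMonoid (S : Type*) extends Monoid S, Inv S where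
  mul_inv_mul : ∀ a : S, a * a⁻¹ * a = a
  inv_mul_inv : ∀ a : S, a⁻¹ * a * a⁻¹ = a⁻¹
  inv_unique : ∀ a b : S, a * b * a = a → b * a * b = b → b = a⁻¹

namespace InverseMonoid

variable {S : Type*} [InverseMonoid S]

/-- The least group congruence `σ` of an inverse monoid: `s σ t` iff `es = et` for some
idempotent `e`. -/
def Sigma (s t : S) : Prop := ∃ e : S, IsIdempotentElem e ∧ e * s = e * t

/-- `S` is `E`-unitary: the projection onto `S/σ` is idempotent pure, i.e. the `σ`-class of `1`
consists of the idempotents of `S`. -/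
def IsEUnitary (S : Type*) [InverseMonoid S] : Prop :=
  ∀ s : S, Sigma s 1 ↔ IsIdempotentElem s

/-- `φ : S → G` exhibits the group `G` as the greatest group image `S/σ` of `S`
(so that `φ s` is the `σ`-class of `s`). -/
def IsGreatestGroupImage {G : Type*} [Group G] (φ : S →* G) : Prop :=
  Function.Surjective φ ∧ ∀ s t : S, φ s = φ t ↔ Sigma s t

/-- `S` is `X`-generated, as an inverse monoid, via the (not necessarily injective) map `ι`. -/
def Generates {X : Type*} (ι : X → S) : Prop :=
  ∀ T : Submonoid S, (∀ x, ι x ∈ T) → (∀ s ∈ T, s⁻¹ ∈ T) → ∀ s, s ∈ T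

theorem inv_inv' (a : S) : (a⁻¹)⁻¹ = a :=
  (inv_unique a⁻¹ a (inv_mul_inv a) (mul_inv_mul a)).symm

theorem idem_mul_inv (a : S) : a * a⁻¹ * (a * a⁻¹) = a * a⁻¹ := by
  rw [← mul_assoc, mul_inv_mul]

theorem idem_inv_mul (a : S) : a⁻¹ * a * (a⁻¹ * a) = a⁻¹ * a := by
  rw [← mul_assoc, inv_mul_inv]

theorem idem_mul {e f : S} (he : e * e = e) (hf : f * f = f) : e * f * (e * f) = e * f := by
  have he' : ∀ z : S, e * (e * z) = e * z := fun z => by rw [← mul_assoc, he]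
  have hf' : ∀ z : S, f * (f * z) = f * z := fun z => by rw [← mul_assoc, hf]
  have h1 := mul_inv_mul (e * f)
  have h2 := inv_mul_inv (e * f)
  set x := (e * f)⁻¹ with hx
  have h2' : ∀ z, x * (e * (f * (x * z))) = x * z := fun z => by
    have := congrArg (· * z) h2
    simpa [mul_assoc] using this
  simp only [mul_assoc] at h1 h2
  have h3 : f * x * e = x := by
    refine inv_unique (e * f) (f * x * e) ?_ ?_
    · simp only [mul_assoc, he', hf', h1]
    · simp only [mul_assoc, he', hf', h2']
  have h4 : x * x = x := by
    conv_lhs => rw [← h3]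
    simp only [mul_assoc, h2']
    simpa [mul_assoc] using h3
  have h5 : x = x⁻¹ := inv_unique x x (by rw [h4, h4]) (by rw [h4, h4])
  have h6 : e * f = x⁻¹ := by
    refine inv_unique x (e * f) ?_ ?_
    · simpa [mul_assoc] using h2
    · simpa [mul_assoc] using h1
  rw [h6, ← h5, h4]

theorem idem_comm {e f : S} (he : e * e = e) (hf : f * f = f) : e * f = f * e := by
  have he' : ∀ z : S, e * (e * z) = e * z := fun z => by rw [← mul_assoc, he]
  have hf' : ∀ z : S, f * (f * z) = f * z := fun z => by rw [← mul_assoc, hf]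
  have h1 := idem_mul he hf
  have h2 := idem_mul hf he
  simp only [mul_assoc] at h1 h2
  have h3 : f * e = (e * f)⁻¹ := inv_unique (e * f) (f * e)
    (by simp only [mul_assoc, he', hf', h1]) (by simp only [mul_assoc, he', hf', h2])
  have h4 : e * f = (e * f)⁻¹ := inv_unique (e * f) (e * f)
    (by simp only [mul_assoc, h1]) (by simp only [mul_assoc, h1])
  rw [h3, ← h4]

/-- If `t` and `tx` lie in the same strong component of the Cayley graph, then the edge from `t`
to `tx` is reversed by the edge from `tx` labelled `x⁻¹`. -/
theorem mul_mul_inv_of_return {t x y : S} (h : t * x * y = t) : t * x * x⁻¹ = t := by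
  have hc := idem_comm (idem_inv_mul t) (idem_mul_inv x)
  have hz : x * x⁻¹ * (x * y) = x * y := by rw [← mul_assoc, mul_inv_mul]
  have ht : t * (t⁻¹ * t) = t := by rw [← mul_assoc, mul_inv_mul]
  have hf : t⁻¹ * t * (x * y) = t⁻¹ * t := by
    rw [mul_assoc, ← mul_assoc t, h]
  calc t * x * x⁻¹ = t * (t⁻¹ * t) * (x * x⁻¹) := by rw [ht, mul_assoc]
    _ = t * (x * x⁻¹ * (t⁻¹ * t)) := by rw [mul_assoc, hc]
    _ = t * (x * x⁻¹ * (t⁻¹ * t * (x * y))) := by rw [hf]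
    _ = t * (x * x⁻¹ * (t⁻¹ * t) * (x * y)) := by simp only [mul_assoc]
    _ = t * (t⁻¹ * t * (x * x⁻¹) * (x * y)) := by rw [hc]
    _ = t * (t⁻¹ * t) * (x * x⁻¹ * (x * y)) := by simp only [mul_assoc]
    _ = t := by rw [ht, hz, ← mul_assoc, h]

theorem map_inv' {G : Type*} [Group G] (φ : S →* G) (a : S) : φ a⁻¹ = (φ a)⁻¹ := by
  have h := congrArg φ (mul_inv_mul a)
  rw [map_mul, map_mul] at h
  exact (inv_eq_of_mul_eq_one_right (mul_eq_right.mp h)).symm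

end InverseMonoid

namespace XGraph

open InverseMonoid

/-! ### Words over `X ∪ X⁻¹` -/

/-- Letters of `X ∪ X⁻¹`: `(x, true)` stands for `x` and `(x, false)` for `x⁻¹`. -/
abbrev Letter (X : Type*) := X × Bool

/-- The free monoid with involution `(X ∪ X⁻¹)*`. -/
abbrev Word (X : Type*) := List (Letter X)

/-- The formal inverse of a letter. -/
def Letter.flip {X : Type*} (a : Letter X) : Letter X := (a.1, !a.2)

/-- The value of a letter in an `X`-generated inverse monoid (or group). -/
def letterVal {X M : Type*} [Inv M] (ι : X → M) (a : Letter X) : M :=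
  if a.2 then ι a.1 else (ι a.1)⁻¹

/-- The value `w_M` of a word in an `X`-generated inverse monoid (or group) `M`. -/
def wordVal {X M : Type*} [Monoid M] [Inv M] (ι : X → M) (w : Word X) : M :=
  (w.map (letterVal ι)).prod

section words

variable {X M : Type*}

@[simp] theorem flip_flip (a : Letter X) : a.flip.flip = a := by
  simp [Letter.flip]

@[simp] theorem wordVal_nil [Monoid M] [Inv M] (ι : X → M) : wordVal ι [] = 1 := rfl

@[simp] theorem wordVal_cons [Monoid M] [Inv M] (ι : X → M) (a : Letter X) (w : Word X) :
    wordVal ι (a :: w) = letterVal ι a * wordVal ι w := by simp [wordVal]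

@[simp] theorem wordVal_append [Monoid M] [Inv M] (ι : X → M) (u w : Word X) :
    wordVal ι (u ++ w) = wordVal ι u * wordVal ι w := by simp [wordVal]

@[simp] theorem letterVal_flip {G : Type*} [Group G] (ι : X → G) (a : Letter X) :
    letterVal ι a.flip = (letterVal ι a)⁻¹ := by
  rcases a with ⟨x, _ | _⟩ <;> simp [letterVal, Letter.flip]

theorem letterVal_flip' {S : Type*} [InverseMonoid S] (ι : X → S) (a : Letter X) :
    letterVal ι a.flip = (letterVal ι a)⁻¹ := by
  rcases a with ⟨x, _ | _⟩ <;> simp [letterVal, Letter.flip, inv_inv']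

theorem map_letterVal {S G : Type*} [InverseMonoid S] [Group G] {ιS : X → S} {ι : X → G}
    {φ : S →* G} (h : ∀ x, φ (ιS x) = ι x) (a : Letter X) :
    φ (letterVal ιS a) = letterVal ι a := by
  rcases a with ⟨x, _ | _⟩ <;> simp [letterVal, map_inv', h]

theorem map_wordVal {S G : Type*} [InverseMonoid S] [Group G] {ιS : X → S} {ι : X → G}
    {φ : S →* G} (h : ∀ x, φ (ιS x) = ι x) (w : Word X) :
    φ (wordVal ιS w) = wordVal ι w := by
  induction w with
  | nil => simp
  | cons a w ih => simp [map_letterVal h, ih]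

end words

/-! ### Subgraphs of the Cayley graph of a group -/

variable {X G : Type*} [Group G]

/-- A subgraph of the Cayley graph of the group `G` with respect to `ι : X → G`. The Cayley graph
has vertex set `G` and, for each `g : G` and each letter `a`, one edge `(g, a)` from `g` to
`g * a_G` labelled `a`; the inverse of this edge is `(g * a_G, a⁻¹)`. -/
@[ext]
structure Subgr (ι : X → G) where
  verts : Set G
  edges : Set (G × Letter X)
  src_mem : ∀ g a, (g, a) ∈ edges → g ∈ verts
  tgt_mem : ∀ g a, (g, a) ∈ edges → g * letterVal ι a ∈ verts
  inv_mem : ∀ g a, (g, a) ∈ edges → (g * letterVal ι a, a.flip) ∈ edges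

namespace Subgr

variable {ι : X → G}

/-- Subgraphs are ordered by inclusion; the join is the union. -/
instance : SemilatticeSup (Subgr ι) where
  le Δ Ξ := Δ.verts ⊆ Ξ.verts ∧ Δ.edges ⊆ Ξ.edges
  le_refl Δ := ⟨subset_rfl, subset_rfl⟩
  le_trans _ _ _ h h' := ⟨h.1.trans h'.1, h.2.trans h'.2⟩
  le_antisymm _ _ h h' := Subgr.ext (h.1.antisymm h'.1) (h.2.antisymm h'.2)
  sup Δ Ξ :=
    { verts := Δ.verts ∪ Ξ.verts
      edges := Δ.edges ∪ Ξ.edges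
      src_mem := fun g a h => h.imp (Δ.src_mem g a) (Ξ.src_mem g a)
      tgt_mem := fun g a h => h.imp (Δ.tgt_mem g a) (Ξ.tgt_mem g a)
      inv_mem := fun g a h => h.imp (Δ.inv_mem g a) (Ξ.inv_mem g a) }
  le_sup_left _ _ := ⟨Set.subset_union_left, Set.subset_union_left⟩
  le_sup_right _ _ := ⟨Set.subset_union_right, Set.subset_union_right⟩
  sup_le _ _ _ h h' := ⟨Set.union_subset h.1 h'.1, Set.union_subset h.2 h'.2⟩

/-- The intersection of a set of subgraphs (the whole Cayley graph if the set is empty). -/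
def inter (Y : Set (Subgr ι)) : Subgr ι where
  verts := {g | ∀ Δ ∈ Y, g ∈ Δ.verts}
  edges := {e | ∀ Δ ∈ Y, e ∈ Δ.edges}
  src_mem g a h Δ hΔ := Δ.src_mem g a (h Δ hΔ)
  tgt_mem g a h Δ hΔ := Δ.tgt_mem g a (h Δ hΔ)
  inv_mem g a h Δ hΔ := Δ.inv_mem g a (h Δ hΔ)

theorem le_inter {Y : Set (Subgr ι)} {Δ : Subgr ι} : Δ ≤ inter Y ↔ ∀ Ξ ∈ Y, Δ ≤ Ξ :=
  ⟨fun h Ξ hΞ => ⟨fun _ hv => h.1 hv Ξ hΞ, fun _ he => h.2 he Ξ hΞ⟩,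
    fun h => ⟨fun _ hv Ξ hΞ => (h Ξ hΞ).1 hv, fun _ he Ξ hΞ => (h Ξ hΞ).2 he⟩⟩

/-- The left translate `gΔ`. -/
instance : SMul G (Subgr ι) where
  smul g Δ :=
    { verts := {v | g⁻¹ * v ∈ Δ.verts}
      edges := {e | (g⁻¹ * e.1, e.2) ∈ Δ.edges}
      src_mem := fun v a h => Δ.src_mem _ a h
      tgt_mem := fun v a h => by simpa [mul_assoc] using Δ.tgt_mem _ a h
      inv_mem := fun v a h => by simpa [mul_assoc] using Δ.inv_mem _ a h }

theorem mem_smul_verts {g v : G} {Δ : Subgr ι} : v ∈ (g • Δ).verts ↔ g⁻¹ * v ∈ Δ.verts := Iff.rfl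

theorem mem_smul_edges {g : G} {e : G × Letter X} {Δ : Subgr ι} :
    e ∈ (g • Δ).edges ↔ (g⁻¹ * e.1, e.2) ∈ Δ.edges := Iff.rfl

instance : MulAction G (Subgr ι) where
  one_smul Δ := by ext <;> simp [mem_smul_verts, mem_smul_edges]
  mul_smul g h Δ := by ext <;> simp [mem_smul_verts, mem_smul_edges, mul_assoc]

theorem smul_mono {g : G} {Δ Ξ : Subgr ι} (h : Δ ≤ Ξ) : g • Δ ≤ g • Ξ :=
  ⟨fun _ hv => h.1 hv, fun _ he => h.2 he⟩

theorem smul_le_iff {g : G} {Δ Ξ : Subgr ι} : g • Δ ≤ Ξ ↔ Δ ≤ g⁻¹ • Ξ :=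
  ⟨fun h => by simpa using smul_mono (g := g⁻¹) h, fun h => by simpa using smul_mono (g := g) h⟩

/-- The subgraph consisting of a single vertex. -/
def single (ι : X → G) (g : G) : Subgr ι where
  verts := {g}
  edges := ∅
  src_mem _ _ h := h.elim
  tgt_mem _ _ h := h.elim
  inv_mem _ _ h := h.elim

/-- The subgraph consisting of the edge `(g, a)`, its inverse, and their end points. -/
def edge (ι : X → G) (g : G) (a : Letter X) : Subgr ι where
  verts := {g, g * letterVal ι a}
  edges := {(g, a), (g * letterVal ι a, a.flip)}
  src_mem := by rintro _ _ (h | h) <;> cases h <;> simp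
  tgt_mem := by rintro _ _ (h | h) <;> cases h <;> simp
  inv_mem := by rintro _ _ (h | h) <;> cases h <;> simp

/-- The subgraph `⟨g w̄⟩` spanned by the path that starts at `g` and is labelled `w`. -/
def span (ι : X → G) : G → Word X → Subgr ι
  | g, [] => single ι g
  | g, a :: w => edge ι g a ⊔ span ι (g * letterVal ι a) w

/-- In the subgraph `Δ`, the word `w` labels a path from `g` to `h`. -/
def HasPath (Δ : Subgr ι) (g : G) (w : Word X) (h : G) : Prop :=
  g * wordVal ι w = h ∧ span ι g w ≤ Δ

/-- `Δ` is connected (in particular, non-empty). -/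
def IsConnected (Δ : Subgr ι) : Prop :=
  Δ.verts.Nonempty ∧ ∀ g ∈ Δ.verts, ∀ h ∈ Δ.verts, ∃ w, Δ.HasPath g w h

/-- `Δ` has finitely many vertices and edges. -/
def IsFinite (Δ : Subgr ι) : Prop := Δ.verts.Finite ∧ Δ.edges.Finite

theorem single_le {g : G} {Δ : Subgr ι} : single ι g ≤ Δ ↔ g ∈ Δ.verts :=
  ⟨fun h => h.1 rfl, fun h => ⟨by rintro _ rfl; exact h, fun _ h => h.elim⟩⟩

theorem edge_le {g : G} {a : Letter X} {Δ : Subgr ι} : edge ι g a ≤ Δ ↔ (g, a) ∈ Δ.edges := by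
  refine ⟨fun h => h.2 (Or.inl rfl), fun h => ⟨?_, ?_⟩⟩
  · rintro _ (rfl | rfl)
    exacts [Δ.src_mem _ _ h, Δ.tgt_mem _ _ h]
  · rintro _ (rfl | rfl)
    exacts [h, Δ.inv_mem _ _ h]

theorem src_mem_span (g : G) (w : Word X) : g ∈ (span ι g w).verts := by
  cases w with
  | nil => exact rfl
  | cons a w => exact Or.inl (Or.inl rfl)

theorem hasPath_nil {Δ : Subgr ι} {g h : G} : Δ.HasPath g [] h ↔ g = h ∧ g ∈ Δ.verts := by
  simp [HasPath, span, single_le]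

theorem hasPath_cons {Δ : Subgr ι} {g h : G} {a : Letter X} {w : Word X} :
    Δ.HasPath g (a :: w) h ↔ (g, a) ∈ Δ.edges ∧ Δ.HasPath (g * letterVal ι a) w h := by
  simp only [HasPath, span, sup_le_iff, edge_le, wordVal_cons, mul_assoc]
  tauto

theorem HasPath.mono {Δ Ξ : Subgr ι} (hle : Δ ≤ Ξ) {g h : G} {w : Word X}
    (hp : Δ.HasPath g w h) : Ξ.HasPath g w h := ⟨hp.1, hp.2.trans hle⟩

theorem HasPath.src {Δ : Subgr ι} {g h : G} {w : Word X} (hp : Δ.HasPath g w h) :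
    g ∈ Δ.verts := hp.2.1 (src_mem_span g w)

theorem HasPath.trans {Δ : Subgr ι} {g h k : G} {u w : Word X} (hu : Δ.HasPath g u h)
    (hw : Δ.HasPath h w k) : Δ.HasPath g (u ++ w) k := by
  induction u generalizing g with
  | nil => obtain ⟨rfl, -⟩ := hasPath_nil.mp hu; exact hw
  | cons a u ih =>
    rw [List.cons_append, hasPath_cons]
    exact ⟨(hasPath_cons.mp hu).1, ih (hasPath_cons.mp hu).2⟩

theorem HasPath.symm {Δ : Subgr ι} {g h : G} {w : Word X} (hp : Δ.HasPath g w h) :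
    ∃ u, Δ.HasPath h u g := by
  induction w generalizing g with
  | nil =>
    obtain ⟨rfl, hg⟩ := hasPath_nil.mp hp
    exact ⟨[], hasPath_nil.mpr ⟨rfl, hg⟩⟩
  | cons a w ih =>
    obtain ⟨he, hp⟩ := hasPath_cons.mp hp
    obtain ⟨u, hu⟩ := ih hp
    refine ⟨u ++ [a.flip], hu.trans (hasPath_cons.mpr ⟨Δ.inv_mem _ _ he, ?_⟩)⟩
    simpa [hasPath_nil] using Δ.src_mem _ _ he

theorem HasPath.tgt {Δ : Subgr ι} {g h : G} {w : Word X} (hp : Δ.HasPath g w h) :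
    h ∈ Δ.verts := hp.symm.choose_spec.src

theorem isConnected_of_base {Δ : Subgr ι} (g : G) (hg : g ∈ Δ.verts)
    (h : ∀ k ∈ Δ.verts, ∃ w, Δ.HasPath g w k) : Δ.IsConnected := by
  refine ⟨⟨g, hg⟩, fun a ha b hb => ?_⟩
  obtain ⟨u, hu⟩ := h a ha
  obtain ⟨v, hv⟩ := h b hb
  obtain ⟨u', hu'⟩ := hu.symm
  exact ⟨_, hu'.trans hv⟩

theorem IsConnected.sup {Δ Ξ : Subgr ι} (hΔ : Δ.IsConnected) (hΞ : Ξ.IsConnected)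
    (h : (Δ.verts ∩ Ξ.verts).Nonempty) : (Δ ⊔ Ξ).IsConnected := by
  obtain ⟨g, hg, hg'⟩ := h
  refine isConnected_of_base g (Or.inl hg) ?_
  rintro k (hk | hk)
  · obtain ⟨w, hw⟩ := hΔ.2 g hg k hk
    exact ⟨w, hw.mono le_sup_left⟩
  · obtain ⟨w, hw⟩ := hΞ.2 g hg' k hk
    exact ⟨w, hw.mono le_sup_right⟩

theorem isConnected_single (g : G) : (single ι g).IsConnected :=
  isConnected_of_base g rfl (by rintro _ rfl; exact ⟨[], hasPath_nil.mpr ⟨rfl, rfl⟩⟩)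

theorem isConnected_edge (g : G) (a : Letter X) : (edge ι g a).IsConnected := by
  refine isConnected_of_base g (Or.inl rfl) ?_
  rintro _ (rfl | rfl)
  · exact ⟨[], hasPath_nil.mpr ⟨rfl, Or.inl rfl⟩⟩
  · exact ⟨[a], hasPath_cons.mpr ⟨Or.inl rfl, hasPath_nil.mpr ⟨rfl, Or.inr rfl⟩⟩⟩

theorem isConnected_span (g : G) (w : Word X) : (span ι g w).IsConnected := by
  induction w generalizing g with
  | nil => exact isConnected_single g
  | cons a w ih => exact (isConnected_edge g a).sup (ih _) ⟨_, Or.inr rfl, src_mem_span _ w⟩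

theorem IsFinite.sup {Δ Ξ : Subgr ι} (hΔ : Δ.IsFinite) (hΞ : Ξ.IsFinite) : (Δ ⊔ Ξ).IsFinite :=
  ⟨hΔ.1.union hΞ.1, hΔ.2.union hΞ.2⟩

theorem isFinite_span (g : G) (w : Word X) : (span ι g w).IsFinite := by
  induction w generalizing g with
  | nil => exact ⟨Set.finite_singleton g, Set.finite_empty⟩
  | cons a w ih => exact IsFinite.sup ⟨Set.toFinite {_, _}, Set.toFinite {_, _}⟩ (ih _)

theorem IsFinite.smul {Δ : Subgr ι} (g : G) (h : Δ.IsFinite) : (g • Δ).IsFinite := by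
  refine ⟨h.1.preimage (mul_right_injective g⁻¹).injOn, h.2.preimage (Function.Injective.injOn ?_)⟩
  rintro ⟨a, x⟩ ⟨b, y⟩ hab
  simpa using hab

theorem HasPath.smul {Δ : Subgr ι} {a b : G} {w : Word X} (g : G) (hp : Δ.HasPath a w b) :
    (g • Δ).HasPath (g * a) w (g * b) := by
  induction w generalizing a with
  | nil =>
    obtain ⟨rfl, ha⟩ := hasPath_nil.mp hp
    exact hasPath_nil.mpr ⟨rfl, by simpa [mem_smul_verts] using ha⟩
  | cons x w ih =>
    obtain ⟨he, hp⟩ := hasPath_cons.mp hp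
    exact hasPath_cons.mpr ⟨by simpa [mem_smul_edges] using he, by simpa [mul_assoc] using ih hp⟩

theorem hasPath_smul_iff {Δ : Subgr ι} {g a b : G} {w : Word X} :
    (g • Δ).HasPath a w b ↔ Δ.HasPath (g⁻¹ * a) w (g⁻¹ * b) :=
  ⟨fun h => by simpa using h.smul g⁻¹, fun h => by simpa using h.smul g⟩

theorem IsConnected.smul {Δ : Subgr ι} (g : G) (h : Δ.IsConnected) : (g • Δ).IsConnected := by
  obtain ⟨⟨v, hv⟩, h⟩ := h
  refine ⟨⟨g * v, by simpa [mem_smul_verts] using hv⟩, fun a ha b hb => ?_⟩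
  obtain ⟨w, hw⟩ := h _ ha _ hb
  exact ⟨w, hasPath_smul_iff.mpr hw⟩

end Subgr

/-- `CSub Γ_X`: the poset of connected subgraphs of the Cayley graph of `G`. -/
abbrev CSub (ι : X → G) := {Δ : Subgr ι // Δ.IsConnected}

namespace CSub

variable {ι : X → G}

instance : MulAction G (CSub ι) where
  smul g Δ := ⟨g • Δ.1, Δ.2.smul g⟩
  one_smul Δ := Subtype.ext (one_smul G Δ.1)
  mul_smul g h Δ := Subtype.ext (mul_smul g h Δ.1)

theorem smul_le_iff {g : G} {Δ Ξ : CSub ι} : g • Δ ≤ Ξ ↔ Δ ≤ g⁻¹ • Ξ := Subgr.smul_le_iff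

theorem smul_mono {g : G} {Δ Ξ : CSub ι} (h : Δ ≤ Ξ) : g • Δ ≤ g • Ξ := Subgr.smul_mono h

/-- The union of two connected subgraphs with a common vertex. -/
def union (Δ Ξ : CSub ι) (h : (Δ.1.verts ∩ Ξ.1.verts).Nonempty) : CSub ι :=
  ⟨Δ.1 ⊔ Ξ.1, Δ.2.sup Ξ.2 h⟩

theorem union_le {Δ Ξ Ω : CSub ι} {h : (Δ.1.verts ∩ Ξ.1.verts).Nonempty} :
    union Δ Ξ h ≤ Ω ↔ Δ ≤ Ω ∧ Ξ ≤ Ω := sup_le_iff (a := Δ.1) (b := Ξ.1) (c := Ω.1)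

/-- The subgraph `⟨g w̄⟩` spanned by the path that starts at `g` and is labelled `w`. -/
def span (ι : X → G) (g : G) (w : Word X) : CSub ι := ⟨Subgr.span ι g w, Subgr.isConnected_span g w⟩

/-- The connected component of the subgraph `I` that contains the connected subgraph `Δ ≤ I`. -/
def component (I : Subgr ι) (Δ : CSub ι) (hΔ : Δ.1 ≤ I) : CSub ι :=
  ⟨{ verts := {h | ∃ g ∈ Δ.1.verts, ∃ w, I.HasPath g w h}
     edges := {e | e ∈ I.edges ∧ ∃ g ∈ Δ.1.verts, ∃ w, I.HasPath g w e.1}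
     src_mem := fun _ _ h => h.2
     tgt_mem := by
       rintro k a ⟨he, g, hg, w, hw⟩
       exact ⟨g, hg, _, hw.trans (Subgr.hasPath_cons.mpr
         ⟨he, Subgr.hasPath_nil.mpr ⟨rfl, I.tgt_mem _ _ he⟩⟩)⟩
     inv_mem := by
       rintro k a ⟨he, g, hg, w, hw⟩
       exact ⟨I.inv_mem _ _ he, g, hg, _, hw.trans (Subgr.hasPath_cons.mpr
         ⟨he, Subgr.hasPath_nil.mpr ⟨rfl, I.tgt_mem _ _ he⟩⟩)⟩ }, by
    have key : ∀ (D : Subgr ι), (∀ e, e ∈ D.edges ↔ e ∈ I.edges ∧ e.1 ∈ D.verts) →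
        ∀ w g k, g ∈ D.verts → I.HasPath g w k → D.HasPath g w k := by
      intro D hD w
      induction w with
      | nil =>
        intro g k hg hp
        exact Subgr.hasPath_nil.mpr ⟨(Subgr.hasPath_nil.mp hp).1, hg⟩
      | cons a w ih =>
        intro g k hg hp
        obtain ⟨he, hp⟩ := Subgr.hasPath_cons.mp hp
        have he' : (g, a) ∈ D.edges := (hD _).mpr ⟨he, hg⟩
        exact Subgr.hasPath_cons.mpr ⟨he', ih _ _ (D.tgt_mem _ _ he') hp⟩
    obtain ⟨g₀, hg₀⟩ := Δ.2.1
    have hb : ∃ g ∈ Δ.1.verts, ∃ w, I.HasPath g w g₀ :=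
      ⟨g₀, hg₀, [], Subgr.hasPath_nil.mpr ⟨rfl, hΔ.1 hg₀⟩⟩
    refine Subgr.isConnected_of_base g₀ hb ?_
    rintro k ⟨g, hg, w, hw⟩
    obtain ⟨u, hu⟩ := Δ.2.2 g₀ hg₀ g hg
    exact ⟨_, key _ (fun e => Iff.rfl) _ _ _ hb ((hu.mono hΔ).trans hw)⟩⟩

theorem component_le (I : Subgr ι) (Δ : CSub ι) (hΔ : Δ.1 ≤ I) : (component I Δ hΔ).1 ≤ I :=
  ⟨by rintro _ ⟨g, hg, w, hw⟩; exact hw.tgt, fun _ h => h.1⟩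

theorem le_component (I : Subgr ι) (Δ : CSub ι) (hΔ : Δ.1 ≤ I) : Δ ≤ component I Δ hΔ := by
  have hv : ∀ g ∈ Δ.1.verts, ∃ k ∈ Δ.1.verts, ∃ w, I.HasPath k w g := fun g hg =>
    ⟨g, hg, [], Subgr.hasPath_nil.mpr ⟨rfl, hΔ.1 hg⟩⟩
  exact ⟨hv, fun e he => ⟨hΔ.2 he, hv _ (Δ.1.src_mem _ _ he)⟩⟩

theorem component_hasPath {I : Subgr ι} {Δ : CSub ι} {hΔ : Δ.1 ≤ I} {g k : G} {w : Word X}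
    (hg : g ∈ (component I Δ hΔ).1.verts) (hp : I.HasPath g w k) :
    (component I Δ hΔ).1.HasPath g w k := by
  induction w generalizing g with
  | nil => exact Subgr.hasPath_nil.mpr ⟨(Subgr.hasPath_nil.mp hp).1, hg⟩
  | cons a w ih =>
    obtain ⟨he, hp⟩ := Subgr.hasPath_cons.mp hp
    have he' : (g, a) ∈ (component I Δ hΔ).1.edges := ⟨he, hg⟩
    exact Subgr.hasPath_cons.mpr ⟨he', ih (Subgr.tgt_mem _ _ _ he') hp⟩

end CSub

/-! ### Closure operators on `CSub Γ_X` -/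

section closure

variable {ι : X → G}

/-- `c` is `G`-invariant. -/
def IsInvariant (c : ClosureOperator (CSub ι)) : Prop :=
  ∀ (g : G) (Δ : CSub ι), c (g • Δ) = g • c Δ

/-- `c` is finitary: `Δ^c` is the union of the closures of the finite connected subgraphs of `Δ`. -/
def IsFinitary (c : ClosureOperator (CSub ι)) : Prop :=
  ∀ Δ : CSub ι,
    (c Δ).1.verts = ⋃ F ∈ {F : CSub ι | F ≤ Δ ∧ F.1.IsFinite}, (c F).1.verts ∧
    (c Δ).1.edges = ⋃ F ∈ {F : CSub ι | F ≤ Δ ∧ F.1.IsFinite}, (c F).1.edges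

/-- `Δ` is compact: it is the closure of a finite connected subgraph. -/
def IsCompactSub (c : ClosureOperator (CSub ι)) (Δ : CSub ι) : Prop :=
  ∃ F : CSub ι, F.1.IsFinite ∧ c F = Δ

/-- `Δ` is closed with respect to the relation `R` on words: for all `R`-related words `u`, `v`
and all vertices `g`, `h` of `Δ`, `u` labels a path in `Δ` from `g` to `h` iff `v` does. -/
def RelClosed (R : Word X → Word X → Prop) (Δ : CSub ι) : Prop :=
  ∀ u v, R u v → ∀ g ∈ Δ.1.verts, ∀ h ∈ Δ.1.verts, Δ.1.HasPath g u h ↔ Δ.1.HasPath g v h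

/-- The closure operator `c_R` on `CSub Γ_X` whose closed elements are the `R`-closed connected
subgraphs; here `R` is a relation such that `R`-related words are equal in `G`. -/
def relClosure (R : Word X → Word X → Prop)
    (hR : ∀ u v, R u v → wordVal ι u = wordVal ι v) : ClosureOperator (CSub ι) :=
  ClosureOperator.ofPred
    (fun Δ => CSub.component
      (Subgr.inter {D | ∃ Ξ : CSub ι, Δ ≤ Ξ ∧ RelClosed R Ξ ∧ Ξ.1 = D}) Δ
      (Subgr.le_inter.mpr (by rintro _ ⟨Ξ, h, -, rfl⟩; exact h)))
    (RelClosed R)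
    (fun Δ => CSub.le_component _ _ _)
    (fun Δ => by
      have key : ∀ u v, wordVal ι u = wordVal ι v →
          (∀ Ξ : CSub ι, RelClosed R Ξ → ∀ g ∈ Ξ.1.verts, ∀ h ∈ Ξ.1.verts,
            Ξ.1.HasPath g u h → Ξ.1.HasPath g v h) →
          ∀ (hI) (g h : G),
          (CSub.component (Subgr.inter {D | ∃ Ξ : CSub ι, Δ ≤ Ξ ∧ RelClosed R Ξ ∧ Ξ.1 = D})
            Δ hI).1.HasPath g u h →
          (CSub.component (Subgr.inter {D | ∃ Ξ : CSub ι, Δ ≤ Ξ ∧ RelClosed R Ξ ∧ Ξ.1 = D})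
            Δ hI).1.HasPath g v h := by
        intro u v huv H hI g h hp
        have hp' := hp.mono (CSub.component_le _ _ _)
        refine CSub.component_hasPath hp.src ⟨huv ▸ hp.1, Subgr.le_inter.mpr ?_⟩
        rintro _ ⟨Ξ, hΞ, hcl, rfl⟩
        have hq : Ξ.1.HasPath g u h := ⟨hp'.1, Subgr.le_inter.mp hp'.2 _ ⟨Ξ, hΞ, hcl, rfl⟩⟩
        exact (H Ξ hcl g hq.src h hq.tgt hq).2
      intro u v huv g hg h hh
      exact ⟨key u v (hR u v huv) (fun Ξ hΞ g hg h hh => (hΞ u v huv g hg h hh).1) _ g h,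
        key v u (hR u v huv).symm (fun Ξ hΞ g hg h hh => (hΞ u v huv g hg h hh).2) _ g h⟩)
    (fun Δ Ξ h hΞ => (CSub.component_le _ _ _).trans
      (Subgr.le_inter.mp le_rfl _ ⟨Ξ, h, hΞ, rfl⟩))

theorem RelClosed.smul {R : Word X → Word X → Prop} {Δ : CSub ι} (h : RelClosed R Δ) (g : G) :
    RelClosed R (g • Δ) := by
  intro u v huv a ha b hb
  exact Subgr.hasPath_smul_iff.trans ((h u v huv _ ha _ hb).trans Subgr.hasPath_smul_iff.symm)

theorem relClosure_invariant (R : Word X → Word X → Prop)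
    (hR : ∀ u v, R u v → wordVal ι u = wordVal ι v) : IsInvariant (relClosure R hR) := by
  have key : ∀ (g : G) (Δ : CSub ι), relClosure R hR (g • Δ) ≤ g • relClosure R hR Δ := by
    intro g Δ
    refine ClosureOperator.closure_min (CSub.smul_mono ((relClosure R hR).le_closure Δ)) ?_
    exact RelClosed.smul ((relClosure R hR).isClosed_closure Δ) g
  intro g Δ
  refine (key g Δ).antisymm ?_
  rw [CSub.smul_le_iff]
  simpa using key g⁻¹ (g • Δ)

end closure

/-! ### Schützenberger graphs and the closure operator of an `E`-unitary inverse monoid -/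

/-- `S` is an `E`-unitary inverse monoid, `X`-generated via `ιS`, with greatest group image `G`
via `φ : S → G`, where `G` is viewed as an `X`-generated group via `ι = φ ∘ ιS`. -/
structure IsXGenEUnitary {S : Type*} [InverseMonoid S] (ιS : X → S) (ι : X → G) (φ : S →* G) :
    Prop where
  generates : Generates ιS
  eUnitary : IsEUnitary S
  image : IsGreatestGroupImage φ
  canonical : ∀ x, φ (ιS x) = ι x

section monoid

variable {S : Type*} [InverseMonoid S] {ιS : X → S} {ι : X → G} {φ : S →* G}

/-- The vertex set of the Schützenberger graph `SΓ(s)`: the strong component of `s` in the Cayley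
graph of `S`. (The path labelled `w` starting at `s` in the Cayley graph of `S` ends at
`s * w_S`.) -/
def strongComponent (ιS : X → S) (s : S) : Set S :=
  {t | (∃ u, s * wordVal ιS u = t) ∧ ∃ v, t * wordVal ιS v = s}

theorem strongComponent_return {s t : S} {a : Letter X} (ht : t ∈ strongComponent ιS s)
    (hta : t * letterVal ιS a ∈ strongComponent ιS s) :
    t * letterVal ιS a * letterVal ιS a.flip = t := by
  obtain ⟨⟨u, hu⟩, -⟩ := ht
  obtain ⟨-, v, hv⟩ := hta
  rw [letterVal_flip']
  refine mul_mul_inv_of_return (y := wordVal ιS (v ++ u)) ?_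
  rw [wordVal_append, ← mul_assoc, hv, hu]

/-- The Schützenberger graph `SΓ(s)`, viewed as a subgraph of the Cayley graph of `G` by means of
the graph morphism induced by `φ`: the edges of `SΓ(s)` are the edges of the Cayley graph of `S`
with both end points in the strong component of `s`. -/
def schutzenbergerSubgr (h : IsXGenEUnitary ιS ι φ) (s : S) : Subgr ι where
  verts := φ '' strongComponent ιS s
  edges := {e | ∃ t ∈ strongComponent ιS s,
    t * letterVal ιS e.2 ∈ strongComponent ιS s ∧ φ t = e.1}
  src_mem := by rintro _ a ⟨t, ht, -, rfl⟩; exact ⟨t, ht, rfl⟩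
  tgt_mem := by
    rintro _ a ⟨t, -, ht, rfl⟩
    exact ⟨_, ht, by rw [map_mul, map_letterVal h.canonical]⟩
  inv_mem := by
    rintro _ a ⟨t, ht, hta, rfl⟩
    refine ⟨_, hta, ?_, by rw [map_mul, map_letterVal h.canonical]⟩
    simpa only [strongComponent_return ht hta] using ht

theorem schutzenbergerSubgr_isConnected (h : IsXGenEUnitary ιS ι φ) (s : S) :
    (schutzenbergerSubgr h s).IsConnected := by
  have hs : s ∈ strongComponent ιS s := ⟨⟨[], by simp⟩, [], by simp⟩
  refine Subgr.isConnected_of_base (φ s) ⟨s, hs, rfl⟩ ?_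
  rintro _ ⟨t, ⟨⟨u, hu⟩, v, hv⟩, rfl⟩
  refine ⟨u, ?_⟩
  have key : ∀ (w : Word X) (r : S), r ∈ strongComponent ιS s → r * wordVal ιS w = t →
      (schutzenbergerSubgr h s).HasPath (φ r) w (φ t) := by
    intro w
    induction w with
    | nil =>
      rintro r hr hrt
      exact Subgr.hasPath_nil.mpr ⟨by rw [← hrt]; simp, r, hr, rfl⟩
    | cons a w ih =>
      rintro r hr hrt
      rw [wordVal_cons, ← mul_assoc] at hrt
      have hra : r * letterVal ιS a ∈ strongComponent ιS s := by
        obtain ⟨⟨p, hp⟩, -⟩ := hr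
        refine ⟨⟨p ++ [a], ?_⟩, w ++ v, ?_⟩
        · rw [wordVal_append, ← mul_assoc, hp]; simp
        · rw [wordVal_append, ← mul_assoc, hrt, hv]
      refine Subgr.hasPath_cons.mpr ⟨⟨r, hr, hra, rfl⟩, ?_⟩
      have := ih _ hra hrt
      rwa [map_mul, map_letterVal h.canonical] at this
  exact key u s hs hu

/-- `SΓ(s)` as an element of `CSub Γ_X`. -/
def schutzenberger (h : IsXGenEUnitary ιS ι φ) (s : S) : CSub ι :=
  ⟨schutzenbergerSubgr h s, schutzenbergerSubgr_isConnected h s⟩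

/-- The closure operator `c_S` on `CSub Γ_X` of an `X`-generated `E`-unitary inverse monoid `S`
with greatest group image `G`: it is `c_R` for the relation `R` of representing the same element
of `S`. -/
def closureOf (h : IsXGenEUnitary ιS ι φ) : ClosureOperator (CSub ι) :=
  relClosure (fun u v => wordVal ιS u = wordVal ιS v) (fun u v huv => by
    rw [← map_wordVal h.canonical, huv, map_wordVal h.canonical])

theorem closureOf_invariant (h : IsXGenEUnitary ιS ι φ) : IsInvariant (closureOf h) :=
  relClosure_invariant _ _

end monoid

/-! ### The inverse monoid of a closure operator -/

/-- The elements of `S_c`: pairs `(Δ, g)` with `Δ` a compact connected subgraph containing `1`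
and `g`. -/
@[ext]
structure MonoidOf {ι : X → G} (c : ClosureOperator (CSub ι)) (hc : IsInvariant c) where
  graph : CSub ι
  elt : G
  compact : IsCompactSub c graph
  one_mem : (1 : G) ∈ graph.1.verts
  elt_mem : elt ∈ graph.1.verts

namespace MonoidOf

variable {ι : X → G} {c : ClosureOperator (CSub ι)} {hc : IsInvariant c}

theorem isClosed_smul (hc : IsInvariant c) {Δ : CSub ι} (h : c.IsClosed Δ) (g : G) :
    c.IsClosed (g • Δ) := by
  rw [c.isClosed_iff] at h ⊢
  exact (hc g Δ).trans (congrArg (g • ·) h)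

theorem _root_.XGraph.IsCompactSub.isClosed {Δ : CSub ι} (h : IsCompactSub c Δ) :
    c.IsClosed Δ := by
  obtain ⟨F, -, rfl⟩ := h
  exact c.isClosed_closure F

theorem _root_.XGraph.IsCompactSub.smul (hc : IsInvariant c) {Δ : CSub ι}
    (h : IsCompactSub c Δ) (g : G) : IsCompactSub c (g • Δ) := by
  obtain ⟨F, hF, rfl⟩ := h
  exact ⟨g • F, hF.smul g, hc g F⟩

/-- A compact graph is the closure of a finite connected graph through any given vertex. -/
theorem _root_.XGraph.IsCompactSub.exists_mem {Δ : CSub ι} (h : IsCompactSub c Δ) {g : G}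
    (hg : g ∈ Δ.1.verts) : ∃ F : CSub ι, F.1.IsFinite ∧ c F = Δ ∧ g ∈ F.1.verts := by
  obtain ⟨F, hF, rfl⟩ := h
  obtain ⟨k, hk⟩ := F.2.1
  obtain ⟨w, hw⟩ := (c F).2.2 g hg k ((c.le_closure F).1 hk)
  have hk' : k ∈ (Subgr.span ι g w).verts := by
    have : (Subgr.span ι g w).HasPath g w k := ⟨hw.1, le_rfl⟩
    exact this.tgt
  refine ⟨CSub.union F (CSub.span ι g w) ⟨k, hk, hk'⟩, hF.sup (Subgr.isFinite_span g w), ?_,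
    Or.inr (Subgr.src_mem_span g w)⟩
  refine le_antisymm ?_ (c.monotone (le_sup_left (a := F.1) (b := Subgr.span ι g w)))
  exact ClosureOperator.closure_min (CSub.union_le.mpr ⟨c.le_closure F, hw.2⟩)
    (c.isClosed_closure F)

theorem _root_.XGraph.IsCompactSub.union {Δ Ξ : CSub ι} (hΔ : IsCompactSub c Δ)
    (hΞ : IsCompactSub c Ξ) (h : (Δ.1.verts ∩ Ξ.1.verts).Nonempty) :
    IsCompactSub c (c (CSub.union Δ Ξ h)) := by
  obtain ⟨g, hg, hg'⟩ := h
  obtain ⟨F, hF, rfl, hgF⟩ := hΔ.exists_mem hg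
  obtain ⟨H, hH, rfl, hgH⟩ := hΞ.exists_mem hg'
  refine ⟨CSub.union F H ⟨g, hgF, hgH⟩, hF.sup hH, le_antisymm ?_ ?_⟩
  · exact c.monotone (sup_le_sup (a := F.1) (b := (c F).1) (c := H.1) (d := (c H).1)
      (c.le_closure F) (c.le_closure H))
  · refine ClosureOperator.closure_min (CSub.union_le.mpr ⟨?_, ?_⟩) (c.isClosed_closure _)
    · exact c.monotone (le_sup_left (a := F.1) (b := H.1))
    · exact c.monotone (le_sup_right (a := F.1) (b := H.1))

theorem inter_nonempty (a b : MonoidOf c hc) :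
    (a.graph.1.verts ∩ (a.elt • b.graph).1.verts).Nonempty :=
  ⟨a.elt, a.elt_mem, by
    change a.elt⁻¹ * a.elt ∈ b.graph.1.verts
    rw [inv_mul_cancel]; exact b.one_mem⟩

/-- `(Δ, g)(Ξ, h) = ((Δ ∪ gΞ)^c, gh)`. -/
instance : Mul (MonoidOf c hc) where
  mul a b :=
    { graph := c (CSub.union a.graph (a.elt • b.graph) (inter_nonempty a b))
      elt := a.elt * b.elt
      compact := a.compact.union (b.compact.smul hc a.elt) _
      one_mem := (c.le_closure _).1 (Or.inl a.one_mem)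
      elt_mem := (c.le_closure _).1 (Or.inr (by
        change a.elt⁻¹ * (a.elt * b.elt) ∈ b.graph.1.verts
        rw [inv_mul_cancel_left]; exact b.elt_mem)) }

/-- The identity element is `({1}^c, 1)`. -/
instance : One (MonoidOf c hc) where
  one :=
    { graph := c (CSub.span ι 1 [])
      elt := 1
      compact := ⟨_, Subgr.isFinite_span 1 [], rfl⟩
      one_mem := (c.le_closure _).1 (Subgr.src_mem_span 1 [])
      elt_mem := (c.le_closure _).1 (Subgr.src_mem_span 1 []) }

/-- `(Δ, g)⁻¹ = (g⁻¹Δ, g⁻¹)`. -/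
instance : Inv (MonoidOf c hc) where
  inv a :=
    { graph := a.elt⁻¹ • a.graph
      elt := a.elt⁻¹
      compact := a.compact.smul hc _
      one_mem := by
        change a.elt⁻¹⁻¹ * 1 ∈ a.graph.1.verts
        simpa using a.elt_mem
      elt_mem := by
        change a.elt⁻¹⁻¹ * a.elt⁻¹ ∈ a.graph.1.verts
        simpa using a.one_mem }

@[simp] theorem elt_mul (a b : MonoidOf c hc) : (a * b).elt = a.elt * b.elt := rfl
@[simp] theorem elt_one : (1 : MonoidOf c hc).elt = 1 := rfl
@[simp] theorem elt_inv (a : MonoidOf c hc) : (a⁻¹).elt = a.elt⁻¹ := rfl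
@[simp] theorem graph_inv (a : MonoidOf c hc) : (a⁻¹).graph = a.elt⁻¹ • a.graph := rfl

theorem graph_mul_le {a b : MonoidOf c hc} {Δ : CSub ι} (hΔ : c.IsClosed Δ) :
    (a * b).graph ≤ Δ ↔ a.graph ≤ Δ ∧ b.graph ≤ a.elt⁻¹ • Δ := by
  refine (ClosureOperator.IsClosed.closure_le_iff hΔ).trans ?_
  rw [CSub.union_le, CSub.smul_le_iff]

theorem graph_one_le {Δ : CSub ι} (hΔ : c.IsClosed Δ) :
    (1 : MonoidOf c hc).graph ≤ Δ ↔ (1 : G) ∈ Δ.1.verts :=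
  (ClosureOperator.IsClosed.closure_le_iff hΔ).trans Subgr.single_le

theorem ext_of {a b : MonoidOf c hc} (he : a.elt = b.elt)
    (hg : ∀ Δ, c.IsClosed Δ → (a.graph ≤ Δ ↔ b.graph ≤ Δ)) : a = b :=
  MonoidOf.ext (le_antisymm ((hg _ b.compact.isClosed).2 le_rfl)
    ((hg _ a.compact.isClosed).1 le_rfl)) he

/-- The inverse monoid `S_c`. -/
instance : InverseMonoid (MonoidOf c hc) where
  mul_assoc x y z := by
    refine ext_of (by simp [mul_assoc]) fun Δ hΔ => ?_
    rw [graph_mul_le hΔ, graph_mul_le hΔ, graph_mul_le hΔ, graph_mul_le (isClosed_smul hc hΔ _),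
      elt_mul, mul_inv_rev, mul_smul, and_assoc]
  one_mul x := by
    refine ext_of (by simp) fun Δ hΔ => ?_
    rw [graph_mul_le hΔ, graph_one_le hΔ, elt_one, inv_one, one_smul]
    exact ⟨fun h => h.2, fun h => ⟨h.1 x.one_mem, h⟩⟩
  mul_one x := by
    refine ext_of (by simp) fun Δ hΔ => ?_
    rw [graph_mul_le hΔ, graph_one_le (isClosed_smul hc hΔ _)]
    refine ⟨fun h => h.1, fun h => ⟨h, ?_⟩⟩
    change x.elt⁻¹⁻¹ * 1 ∈ Δ.1.verts
    simpa using h.1 x.elt_mem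
  mul_inv_mul x := by
    refine ext_of (by simp) fun Δ hΔ => ?_
    rw [graph_mul_le hΔ, graph_mul_le hΔ]
    simp [CSub.smul_le_iff]
  inv_mul_inv x := by
    refine ext_of (by simp) fun Δ hΔ => ?_
    rw [graph_mul_le hΔ, graph_mul_le hΔ]
    simp [CSub.smul_le_iff]
  inv_unique x y hx hy := by
    have he : y.elt = x.elt⁻¹ := by
      have := congrArg MonoidOf.elt hx
      simp only [elt_mul, mul_eq_right] at this
      exact eq_inv_of_mul_eq_one_right this
    have h1 := ((graph_mul_le x.compact.isClosed).1 (le_of_eq (congrArg graph hx))).1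
    have h2 := ((graph_mul_le y.compact.isClosed).1 (le_of_eq (congrArg graph hy))).1
    rw [graph_mul_le x.compact.isClosed] at h1
    rw [graph_mul_le y.compact.isClosed, he, inv_inv] at h2
    refine MonoidOf.ext (le_antisymm h1.2 ?_) he
    rw [graph_inv, CSub.smul_le_iff, inv_inv]
    exact h2.2

/-- The map `X → S_c`, `x ↦ (⟨x̄⟩^c, x_G)`. -/
def gen (c : ClosureOperator (CSub ι)) (hc : IsInvariant c) (x : X) : MonoidOf c hc where
  graph := c (CSub.span ι 1 [(x, true)])
  elt := ι x
  compact := ⟨_, Subgr.isFinite_span 1 _, rfl⟩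
  one_mem := (c.le_closure _).1 (Subgr.src_mem_span 1 _)
  elt_mem := (c.le_closure _).1 (Or.inr (by simp [Subgr.span, Subgr.single, letterVal]))

/-- The projection `S_c → G`, `(Δ, g) ↦ g`. -/
def proj (c : ClosureOperator (CSub ι)) (hc : IsInvariant c) : MonoidOf c hc →* G where
  toFun := MonoidOf.elt
  map_one' := rfl
  map_mul' _ _ := rfl

end MonoidOf

end XGraph

/-!
Write `e ≤ f` for idempotents with `e f = e`. In an `E`-unitary inverse monoid `S` two elements
with the same image in `G` and the same idempotent `s s⁻¹` coincide. Hence `SΓ(s)`, the set of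
all `t` with `t t⁻¹ = s s⁻¹`, embeds in the Cayley graph of `G`, and a word `w` labels a path of
`SΓ(s)` starting at `1` iff `s s⁻¹ ≤ w_S (w_S)⁻¹`. Conversely, a subgraph that is closed for
equality in `S` and contains the path `w` at `g` contains every path `p` at `g` with
`w_S (w_S)⁻¹ ≤ p_S (p_S)⁻¹`, because `w w⁻¹` and `w w⁻¹ p p⁻¹` have the same value. So the
closure of the subgraph spanned by the path `w` at `1` is `SΓ(w_S)`.

In `S_c` the value of `w` is the pair `(⟨w̄⟩^c, w_G)`, where `⟨w̄⟩` is spanned by the path `w`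
at `1`. Comparing values of words in `S` and in `S_{c_S}` yields (1). For (2), a closed `Δ`
contains the path `w` at `g` iff the graph of the value of `w` lies in `g⁻¹Δ`, so closed
subgraphs are closed for equality in `S_c`; the converse holds since finite connected subgraphs
are spanned by paths and `c` is finitary.
-/

namespace InverseMonoid

variable {S : Type*} [InverseMonoid S]

theorem inv_eq_self_of_isIdempotentElem {e : S} (he : IsIdempotentElem e) : e⁻¹ = e :=
  (inv_unique e e (by rw [he.eq, he.eq]) (by rw [he.eq, he.eq])).symm

theorem mul_inv_rev' (a b : S) : (a * b)⁻¹ = b⁻¹ * a⁻¹ := by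
  have hcomm := idem_comm (idem_inv_mul a) (idem_mul_inv b)
  refine (inv_unique _ _ ?_ ?_).symm
  · calc a * b * (b⁻¹ * a⁻¹) * (a * b) = a * (b * b⁻¹ * (a⁻¹ * a)) * b := by simp only [mul_assoc]
      _ = a * a⁻¹ * a * (b * b⁻¹ * b) := by rw [← hcomm]; simp only [mul_assoc]
      _ = a * b := by rw [mul_inv_mul, mul_inv_mul]
  · calc b⁻¹ * a⁻¹ * (a * b) * (b⁻¹ * a⁻¹) = b⁻¹ * (a⁻¹ * a * (b * b⁻¹)) * a⁻¹ := by
          simp only [mul_assoc]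
      _ = b⁻¹ * b * b⁻¹ * (a⁻¹ * a * a⁻¹) := by rw [hcomm]; simp only [mul_assoc]
      _ = b⁻¹ * a⁻¹ := by rw [inv_mul_inv, inv_mul_inv]

theorem mul_mul_inv_of_isIdempotentElem {e : S} (he : IsIdempotentElem e) (s : S) :
    e * s * (e * s)⁻¹ = e * (s * s⁻¹) := by
  calc e * s * (e * s)⁻¹ = e * (s * s⁻¹ * e) := by
        rw [mul_inv_rev', inv_eq_self_of_isIdempotentElem he]; simp only [mul_assoc]
    _ = e * (s * s⁻¹) := by rw [idem_comm (idem_mul_inv s) he, ← mul_assoc, he.eq]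

theorem map_inv_of_mulHomClass {T F : Type*} [InverseMonoid T] [FunLike F S T] [MulHomClass F S T]
    (f : F) (a : S) : f a⁻¹ = (f a)⁻¹ :=
  inv_unique _ _ (by rw [← map_mul, ← map_mul, mul_inv_mul])
    (by rw [← map_mul, ← map_mul, inv_mul_inv])

section groupImage

variable {G : Type*} [Group G] {φ : S →* G}

theorem map_mul_inv_self (φ : S →* G) (s : S) : φ (s * s⁻¹) = 1 := by
  rw [map_mul, map_inv', mul_inv_cancel]

theorem surjective_of_closure_eq_top {A : Set G} (hA : Subgroup.closure A = ⊤)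
    (hφ : A ⊆ Set.range φ) : Function.Surjective φ := by
  intro g
  have hg : g ∈ Subgroup.closure A := hA ▸ Subgroup.mem_top g
  induction hg using Subgroup.closure_induction with
  | mem a ha => exact hφ ha
  | one => exact ⟨1, map_one φ⟩
  | mul _ _ _ _ hs ht =>
    obtain ⟨s, rfl⟩ := hs
    obtain ⟨t, rfl⟩ := ht
    exact ⟨s * t, map_mul φ s t⟩
  | inv _ _ hs =>
    obtain ⟨s, rfl⟩ := hs
    exact ⟨s⁻¹, map_inv' φ s⟩

/-- A homomorphism to a group is idempotent pure if only idempotents are mapped to `1`. For the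
projection onto the greatest group image this is what `E`-unitarity provides. -/
def IsIdempotentPure (φ : S →* G) : Prop := ∀ s, φ s = 1 → IsIdempotentElem s

theorem IsEUnitary.isIdempotentPure (hS : IsEUnitary S) (hφ : IsGreatestGroupImage φ) :
    IsIdempotentPure φ := fun s hs =>
  (hS s).1 ((hφ.2 s 1).1 (hs.trans (map_one φ).symm))

theorem IsIdempotentPure.eq_of_mul_inv_eq (hφ : IsIdempotentPure φ) {s t : S}
    (hst : s * s⁻¹ = t * t⁻¹) (hmap : φ s = φ t) : s = t := by
  have hidem : IsIdempotentElem (s⁻¹ * t) :=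
    hφ _ (by rw [map_mul, map_inv', hmap, inv_mul_cancel])
  have hself_inv : t⁻¹ * s = s⁻¹ * t := by
    rw [← inv_eq_self_of_isIdempotentElem hidem, mul_inv_rev', inv_inv']
  have hs : s * (s⁻¹ * t) = t := by rw [← mul_assoc, hst, mul_inv_mul]
  have ht : t * (s⁻¹ * t) = s := by rw [← hself_inv, ← mul_assoc, ← hst, mul_inv_mul]
  calc s = s * (s⁻¹ * t) * (s⁻¹ * t) := by rw [hs, ht]
    _ = t := by rw [mul_assoc, hidem.eq, hs]

end groupImage

end InverseMonoid

namespace XGraph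

open InverseMonoid

variable {X G : Type*} [Group G] {ι : X → G}

/-- The formal inverse of a word. -/
def Word.inv (w : Word X) : Word X := (w.map Letter.flip).reverse

@[simp] theorem Word.inv_nil : Word.inv ([] : Word X) = [] := rfl

@[simp] theorem Word.inv_cons (a : Letter X) (w : Word X) :
    Word.inv (a :: w) = Word.inv w ++ [a.flip] := by
  simp [Word.inv]

@[simp] theorem Word.inv_inv (w : Word X) : Word.inv (Word.inv w) = w := by
  simp [Word.inv, Function.comp_def]

section words

variable {S : Type*} [InverseMonoid S] {ιS : X → S}

theorem wordVal_inv (ιS : X → S) (w : Word X) :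
    wordVal ιS (Word.inv w) = (wordVal ιS w)⁻¹ := by
  induction w with
  | nil => exact (inv_eq_self_of_isIdempotentElem (mul_one 1)).symm
  | cons a w ih =>
    simp only [Word.inv_cons, wordVal_append, wordVal_cons, wordVal_nil, mul_one, ih,
      letterVal_flip', mul_inv_rev']

theorem generates_iff_surjective_wordVal :
    Generates ιS ↔ Function.Surjective (wordVal ιS) := by
  refine ⟨fun h => ?_, fun h T hι hinv s => ?_⟩
  · let values : Submonoid S :=
      { carrier := Set.range (wordVal ιS)
        one_mem' := ⟨[], rfl⟩
        mul_mem' := by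
          rintro _ _ ⟨u, rfl⟩ ⟨v, rfl⟩
          exact ⟨u ++ v, wordVal_append ιS u v⟩ }
    refine h values (fun x => ⟨[(x, true)], by simp [letterVal]⟩) ?_
    rintro _ ⟨w, rfl⟩
    exact ⟨Word.inv w, wordVal_inv ιS w⟩
  · obtain ⟨w, rfl⟩ := h s
    refine T.list_prod_mem fun m hm => ?_
    obtain ⟨⟨x, _ | _⟩, -, rfl⟩ := List.mem_map.1 hm
    exacts [hinv _ (hι x), hι x]

end words

namespace Subgr

variable {Δ Ξ : Subgr ι} {g h : G} {a : Letter X} {u v w : Word X}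

theorem span_le : span ι g w ≤ Δ ↔ Δ.HasPath g w (g * wordVal ι w) :=
  (and_iff_right rfl).symm

theorem span_append (g : G) (u v : Word X) :
    span ι g (u ++ v) = span ι g u ⊔ span ι (g * wordVal ι u) v := by
  induction u generalizing g with
  | nil =>
    rw [List.nil_append, wordVal_nil, mul_one]
    exact (sup_eq_right.2 (single_le.2 (src_mem_span g v))).symm
  | cons a u ih => simp only [List.cons_append, span, ih, wordVal_cons, sup_assoc, mul_assoc]

theorem hasPath_append : Δ.HasPath g (u ++ v) h ↔
    Δ.HasPath g u (g * wordVal ι u) ∧ Δ.HasPath (g * wordVal ι u) v h := by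
  simp only [HasPath, span_append, sup_le_iff, wordVal_append, mul_assoc]
  tauto

theorem hasPath_singleton : Δ.HasPath g [a] h ↔ (g, a) ∈ Δ.edges ∧ g * letterVal ι a = h := by
  rw [hasPath_cons, hasPath_nil]
  exact and_congr_right fun he => and_iff_left (Δ.tgt_mem g a he)

theorem HasPath.inv (hp : Δ.HasPath g w h) : Δ.HasPath h (Word.inv w) g := by
  induction w generalizing g with
  | nil =>
    obtain ⟨rfl, hg⟩ := hasPath_nil.1 hp
    exact hasPath_nil.2 ⟨rfl, hg⟩
  | cons a w ih =>
    obtain ⟨he, hp⟩ := hasPath_cons.1 hp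
    rw [Word.inv_cons]
    exact (ih hp).trans (hasPath_singleton.2 ⟨Δ.inv_mem _ _ he, by simp⟩)

theorem hasPath_inv : Δ.HasPath h (Word.inv w) g ↔ Δ.HasPath g w h :=
  ⟨fun hp => Word.inv_inv w ▸ hp.inv, HasPath.inv⟩

theorem span_inv (g : G) (w : Word X) :
    span ι (g * wordVal ι w) (Word.inv w) = span ι g w := by
  have hsrc : g * wordVal ι w * wordVal ι (Word.inv w) = g :=
    (HasPath.inv (Δ := span ι g w) ⟨rfl, le_rfl⟩).1
  exact eq_of_forall_ge_iff fun Δ => by rw [span_le, hsrc, hasPath_inv, span_le]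

theorem smul_span (g h : G) (w : Word X) : g • span ι h w = span ι (g * h) w :=
  eq_of_forall_ge_iff fun Δ => by
    rw [smul_le_iff, span_le, hasPath_smul_iff, inv_inv, span_le, mul_assoc]

theorem HasPath.of_edges_subset (hp : Δ.HasPath g w h) (hg : g ∈ Ξ.verts)
    (hle : Δ.edges ⊆ Ξ.edges) : Ξ.HasPath g w h := by
  induction w generalizing g with
  | nil => exact hasPath_nil.2 ⟨(hasPath_nil.1 hp).1, hg⟩
  | cons a w ih =>
    obtain ⟨he, hp⟩ := hasPath_cons.1 hp
    exact hasPath_cons.2 ⟨hle he, ih hp (Ξ.tgt_mem _ _ (hle he))⟩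

theorem IsConnected.le_of_edges_subset (hΔ : Δ.IsConnected) (hg : g ∈ Δ.verts)
    (hg' : g ∈ Ξ.verts) (hle : Δ.edges ⊆ Ξ.edges) : Δ ≤ Ξ := by
  refine ⟨fun k hk => ?_, hle⟩
  obtain ⟨w, hw⟩ := hΔ.2 g hg k hk
  exact (hw.of_edges_subset hg' hle).tgt

theorem IsConnected.le_of_hasPath (hΔ : Δ.IsConnected) (hg : g ∈ Δ.verts)
    (h : ∀ w k, Δ.HasPath g w k → Ξ.HasPath g w k) : Δ ≤ Ξ := by
  have hg' : g ∈ Ξ.verts := (h [] g (hasPath_nil.2 ⟨rfl, hg⟩)).src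
  refine hΔ.le_of_edges_subset hg hg' ?_
  rintro ⟨k, a⟩ he
  obtain ⟨w, hw⟩ := hΔ.2 g hg k (Δ.src_mem k a he)
  have hlast := (hasPath_append.1 (h _ _ (hw.trans (hasPath_singleton.2 ⟨he, rfl⟩)))).2
  rw [hw.1] at hlast
  exact (hasPath_singleton.1 hlast).1

theorem IsConnected.exists_hasPath_subset_edges_span (hΔ : Δ.IsConnected) (hg : g ∈ Δ.verts)
    {E : Set (G × Letter X)} (hE : E.Finite) (hsub : E ⊆ Δ.edges) :
    ∃ w h, Δ.HasPath g w h ∧ E ⊆ (span ι g w).edges := by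
  induction E, hE using Set.Finite.induction_on with
  | empty => exact ⟨[], g, hasPath_nil.2 ⟨rfl, hg⟩, Set.empty_subset _⟩
  | @insert e E _ _ ih =>
    obtain ⟨k, a⟩ := e
    obtain ⟨he, hsub⟩ := Set.insert_subset_iff.1 hsub
    obtain ⟨w, h, hw, hE⟩ := ih hsub
    obtain ⟨u, hu⟩ := hΔ.2 h hw.tgt k (Δ.src_mem k a he)
    have hwu := hw.trans hu
    refine ⟨w ++ u ++ [a], _, hwu.trans (hasPath_singleton.2 ⟨he, rfl⟩), ?_⟩
    rw [span_append, hwu.1, span_append]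
    exact Set.insert_subset (Or.inr (Or.inl (Or.inl rfl)))
      (hE.trans (Set.subset_union_left.trans Set.subset_union_left))

theorem IsConnected.exists_span_eq (hΔ : Δ.IsConnected) (hfin : Δ.IsFinite) (hg : g ∈ Δ.verts) :
    ∃ w, span ι g w = Δ := by
  obtain ⟨w, h, hw, hE⟩ := hΔ.exists_hasPath_subset_edges_span hg hfin.2 subset_rfl
  exact ⟨w, le_antisymm hw.2 (hΔ.le_of_edges_subset hg (src_mem_span g w) hE)⟩

end Subgr

theorem CSub.smul_span (g h : G) (w : Word X) : g • CSub.span ι h w = CSub.span ι (g * h) w :=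
  Subtype.ext (Subgr.smul_span g h w)

theorem IsFinitary.isClosed_of_forall_isFinite {c : ClosureOperator (CSub ι)} (hc : IsFinitary c)
    {Δ : CSub ι} (h : ∀ F : CSub ι, F ≤ Δ → F.1.IsFinite → c F ≤ Δ) : c.IsClosed Δ := by
  refine c.isClosed_iff.2 (le_antisymm (show (c Δ).1 ≤ Δ.1 from ⟨?_, ?_⟩) (c.le_closure Δ))
  · rw [(hc Δ).1]
    exact Set.iUnion₂_subset fun F hF => (h F hF.1 hF.2).1
  · rw [(hc Δ).2]
    exact Set.iUnion₂_subset fun F hF => (h F hF.1 hF.2).2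

section schutzenbergerGraphs

variable {S : Type*} [InverseMonoid S] {ιS : X → S}

/-- The subgraphs that are closed with respect to the relation of having the same value in `S`;
for `E`-unitary `S` these are the closed elements of `c_S`. -/
abbrev WordClosed (ιS : X → S) (Δ : CSub ι) : Prop :=
  RelClosed (fun u v => wordVal ιS u = wordVal ιS v) Δ

theorem WordClosed.hasPath_of_mul_inv_le {Δ : CSub ι} (hΔ : WordClosed ιS Δ) {w p : Word X}
    {g h : G} (hw : Δ.1.HasPath g w h)
    (hle : wordVal ιS w * (wordVal ιS w)⁻¹ * (wordVal ιS p * (wordVal ιS p)⁻¹) =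
      wordVal ιS w * (wordVal ιS w)⁻¹) : Δ.1.HasPath g p (g * wordVal ι p) := by
  have hloop : Δ.1.HasPath g (w ++ Word.inv w) g := hw.trans hw.inv
  have hval : wordVal ιS (w ++ Word.inv w) =
      wordVal ιS (w ++ Word.inv w ++ (p ++ Word.inv p)) := by
    simp only [wordVal_append, wordVal_inv, hle]
  have hdetour := (hΔ _ _ hval g hw.src g hw.src).1 hloop
  have htail := (Subgr.hasPath_append.1 hdetour).2
  rw [hloop.1] at htail
  exact (Subgr.hasPath_append.1 htail).1

theorem mem_strongComponent_iff (hS : Generates ιS) {s t : S} :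
    t ∈ strongComponent ιS s ↔ t * t⁻¹ = s * s⁻¹ := by
  constructor
  · rintro ⟨⟨u, rfl⟩, v, hv⟩
    rw [mul_inv_rev', ← mul_assoc, mul_mul_inv_of_return hv]
  · intro hts
    have hsurj := generates_iff_surjective_wordVal.1 hS
    obtain ⟨u, hu⟩ := hsurj (s⁻¹ * t)
    obtain ⟨v, hv⟩ := hsurj (t⁻¹ * s)
    exact ⟨⟨u, by rw [hu, ← mul_assoc, ← hts, mul_inv_mul]⟩,
      v, by rw [hv, ← mul_assoc, hts, mul_inv_mul]⟩

theorem self_mem_strongComponent (ιS : X → S) (s : S) : s ∈ strongComponent ιS s :=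
  ⟨⟨[], mul_one s⟩, [], mul_one s⟩

theorem mul_inv_mem_strongComponent (hS : Generates ιS) (s : S) :
    s * s⁻¹ ∈ strongComponent ιS s := by
  rw [mem_strongComponent_iff hS, mul_inv_rev', inv_inv', idem_mul_inv]

theorem mul_wordVal_mem_strongComponent_of_append {s t : S} {u v : Word X}
    (ht : t ∈ strongComponent ιS s) (huv : t * wordVal ιS (u ++ v) ∈ strongComponent ιS s) :
    t * wordVal ιS u ∈ strongComponent ιS s := by
  obtain ⟨⟨p, hp⟩, -⟩ := ht
  obtain ⟨-, q, hq⟩ := huv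
  refine ⟨⟨p ++ u, by rw [wordVal_append, ← mul_assoc, hp]⟩, v ++ q, ?_⟩
  rw [← hq]
  simp only [wordVal_append, mul_assoc]

variable {φ : S →* G} (h : IsXGenEUnitary ιS ι φ)

include h in
theorem IsXGenEUnitary.isIdempotentPure : IsIdempotentPure φ :=
  h.eUnitary.isIdempotentPure h.image

include h in
theorem IsXGenEUnitary.injOn_strongComponent (s : S) : Set.InjOn φ (strongComponent ιS s) :=
  fun _ hr _ ht hrt => h.isIdempotentPure.eq_of_mul_inv_eq
    (((mem_strongComponent_iff h.generates).1 hr).trans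
      ((mem_strongComponent_iff h.generates).1 ht).symm) hrt

theorem hasPath_schutzenbergerSubgr_iff {s t : S} (ht : t ∈ strongComponent ιS s) {w : Word X}
    {k : G} : (schutzenbergerSubgr h s).HasPath (φ t) w k ↔
      φ t * wordVal ι w = k ∧ t * wordVal ιS w ∈ strongComponent ιS s := by
  induction w generalizing t with
  | nil =>
    have hφt : φ t ∈ (schutzenbergerSubgr h s).verts := ⟨t, ht, rfl⟩
    simp only [Subgr.hasPath_nil, wordVal_nil, mul_one, ht, hφt]
  | cons a w ih =>
    rw [Subgr.hasPath_cons, wordVal_cons, wordVal_cons, ← mul_assoc, ← mul_assoc,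
      ← map_letterVal h.canonical, ← map_mul]
    constructor
    · rintro ⟨⟨r, hr, hra, hrt⟩, hp⟩
      obtain rfl : r = t := h.injOn_strongComponent s hr ht hrt
      exact (ih hra).1 hp
    · rintro ⟨hk, hw⟩
      have hta : t * letterVal ιS a ∈ strongComponent ιS s := by
        simpa using mul_wordVal_mem_strongComponent_of_append (u := [a]) (v := w) ht
          (by simpa [mul_assoc] using hw)
      exact ⟨⟨t, ht, hta, rfl⟩, (ih hta).2 ⟨hk, hw⟩⟩

theorem wordClosed_schutzenberger (s : S) : WordClosed ιS (schutzenberger h s) := by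
  rintro u v huv _ ⟨t, ht, rfl⟩ k -
  have hval : wordVal ι u = wordVal ι v := by
    rw [← map_wordVal h.canonical, ← map_wordVal h.canonical, huv]
  exact (hasPath_schutzenbergerSubgr_iff h ht).trans
    (by rw [huv, hval]; exact (hasPath_schutzenbergerSubgr_iff h ht).symm)

theorem hasPath_one_schutzenberger_iff {s : S} {w : Word X} {k : G} :
    (schutzenberger h s).1.HasPath 1 w k ↔
      wordVal ι w = k ∧ s * s⁻¹ * (wordVal ιS w * (wordVal ιS w)⁻¹) = s * s⁻¹ := by
  have hpath := hasPath_schutzenbergerSubgr_iff h (mul_inv_mem_strongComponent h.generates s)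
    (w := w) (k := k)
  rwa [map_mul_inv_self, one_mul, mem_strongComponent_iff h.generates,
    mul_mul_inv_of_isIdempotentElem (idem_mul_inv s)] at hpath

theorem hasPath_one_schutzenberger_wordVal (w : Word X) :
    (schutzenberger h (wordVal ιS w)).1.HasPath 1 w (wordVal ι w) :=
  (hasPath_one_schutzenberger_iff h).2 ⟨rfl, idem_mul_inv _⟩

theorem closureOf_span_one (w : Word X) :
    closureOf h (CSub.span ι 1 w) = schutzenberger h (wordVal ιS w) := by
  have hself := hasPath_one_schutzenberger_wordVal h w
  apply le_antisymm
  · exact ClosureOperator.closure_min hself.2 (wordClosed_schutzenberger h _)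
  · refine (schutzenberger h _).2.le_of_hasPath hself.src fun p k hp => ?_
    obtain ⟨rfl, hle⟩ := (hasPath_one_schutzenberger_iff h).1 hp
    have hclosed : WordClosed ιS (closureOf h (CSub.span ι 1 w)) :=
      (closureOf h).isClosed_closure _
    have hw := Subgr.span_le.1 ((closureOf h).le_closure (CSub.span ι 1 w))
    simpa only [one_mul] using hclosed.hasPath_of_mul_inv_le hw hle

theorem mul_inv_le_of_schutzenberger_le {s t : S} (hle : schutzenberger h s ≤ schutzenberger h t) :
    t * t⁻¹ * (s * s⁻¹) = t * t⁻¹ := by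
  obtain ⟨w, rfl⟩ := generates_iff_surjective_wordVal.1 h.generates s
  have hw := (hasPath_one_schutzenberger_wordVal h w).mono hle
  exact ((hasPath_one_schutzenberger_iff h).1 hw).2

theorem eq_of_schutzenberger_eq {s t : S} (hΓ : schutzenberger h s = schutzenberger h t)
    (hφ : φ s = φ t) : s = t := by
  refine h.isIdempotentPure.eq_of_mul_inv_eq ?_ hφ
  calc s * s⁻¹ = s * s⁻¹ * (t * t⁻¹) := (mul_inv_le_of_schutzenberger_le h hΓ.ge).symm
    _ = t * t⁻¹ * (s * s⁻¹) := idem_comm (idem_mul_inv s) (idem_mul_inv t)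
    _ = t * t⁻¹ := mul_inv_le_of_schutzenberger_le h hΓ.le

end schutzenbergerGraphs

namespace MonoidOf

variable {c : ClosureOperator (CSub ι)} {hc : IsInvariant c} {Δ : CSub ι}

theorem elt_wordVal (w : Word X) : (wordVal (gen c hc) w).elt = wordVal ι w :=
  map_wordVal (φ := proj c hc) (fun _ => rfl) w

theorem graph_letterVal (a : Letter X) :
    (letterVal (gen c hc) a).graph = c (CSub.span ι 1 [a]) := by
  obtain ⟨x, _ | _⟩ := a
  · have hspan : CSub.span ι (ι x)⁻¹ [(x, true)] = CSub.span ι 1 [(x, false)] :=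
      Subtype.ext (by
        simpa [CSub.span, letterVal, Letter.flip] using
          (Subgr.span_inv (ι := ι) (ι x)⁻¹ [(x, true)]).symm)
    calc (ι x)⁻¹ • c (CSub.span ι 1 [(x, true)])
        = c ((ι x)⁻¹ • CSub.span ι 1 [(x, true)]) := (hc _ _).symm
      _ = c (CSub.span ι 1 [(x, false)]) := by rw [CSub.smul_span, mul_one, hspan]
  · rfl

theorem graph_wordVal_le_iff (hΔ : c.IsClosed Δ) (w : Word X) :
    (wordVal (gen c hc) w).graph ≤ Δ ↔ CSub.span ι 1 w ≤ Δ := by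
  induction w generalizing Δ with
  | nil => exact (graph_one_le hΔ).trans Subgr.single_le.symm
  | cons a w ih =>
    have helt : (letterVal (gen c hc) a).elt = letterVal ι a :=
      map_letterVal (φ := proj c hc) (fun _ => rfl) a
    have hspan : CSub.span ι 1 (a :: w) ≤ Δ ↔
        CSub.span ι 1 [a] ≤ Δ ∧ CSub.span ι (letterVal ι a) w ≤ Δ := by
      change Subgr.span ι 1 ([a] ++ w) ≤ Δ.1 ↔ _
      rw [Subgr.span_append, sup_le_iff]
      simp [CSub.span, ← Subtype.coe_le_coe]
    rw [wordVal_cons, graph_mul_le hΔ, ih (isClosed_smul hc hΔ _), graph_letterVal,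
      ClosureOperator.IsClosed.closure_le_iff hΔ, ← CSub.smul_le_iff, CSub.smul_span, helt,
      mul_one, hspan]

theorem graph_wordVal (w : Word X) : (wordVal (gen c hc) w).graph = c (CSub.span ι 1 w) := by
  have hclosed := (wordVal (gen c hc) w).compact.isClosed
  exact le_antisymm ((graph_wordVal_le_iff (c.isClosed_closure _) w).2 (c.le_closure _))
    (ClosureOperator.closure_min ((graph_wordVal_le_iff hclosed w).1 le_rfl) hclosed)

theorem hasPath_iff_graph_wordVal_le (hc : IsInvariant c) (hΔ : c.IsClosed Δ) {g k : G}
    {w : Word X} : Δ.1.HasPath g w k ↔ g * (wordVal (gen c hc) w).elt = k ∧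
      (wordVal (gen c hc) w).graph ≤ g⁻¹ • Δ := by
  rw [elt_wordVal, graph_wordVal_le_iff (isClosed_smul hc hΔ _), ← CSub.smul_le_iff,
    CSub.smul_span, mul_one]
  rfl

theorem surjective_wordVal_gen : Function.Surjective (wordVal (gen c hc)) := by
  intro a
  obtain ⟨F, hfin, hF, hone⟩ := a.compact.exists_mem a.one_mem
  obtain ⟨w, hw⟩ := F.2.exists_span_eq hfin hone
  have hFa : F ≤ a.graph := hF ▸ c.le_closure F
  have hpw : a.graph.1.HasPath 1 w (wordVal ι w) := ⟨one_mul _, hw.trans_le hFa⟩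
  obtain ⟨u, hu⟩ := a.graph.2.2 _ hpw.tgt _ a.elt_mem
  have hwu := hpw.trans hu
  refine ⟨w ++ u, MonoidOf.ext ?_ (by rw [elt_wordVal, ← hwu.1, one_mul])⟩
  have hle : F ≤ CSub.span ι 1 (w ++ u) := by
    change F.1 ≤ Subgr.span ι 1 (w ++ u)
    rw [Subgr.span_append, hw]
    exact le_sup_left
  rw [graph_wordVal]
  exact le_antisymm (ClosureOperator.closure_min hwu.2 a.compact.isClosed)
    (hF.symm.trans_le (c.monotone hle))

theorem mul_inv_mul_mul_inv_eq_iff {a b : MonoidOf c hc} :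
    a * a⁻¹ * (b * b⁻¹) = a * a⁻¹ ↔ b.graph ≤ a.graph := by
  have hgraph : ∀ d : MonoidOf c hc, ∀ Ω, c.IsClosed Ω → ((d * d⁻¹).graph ≤ Ω ↔ d.graph ≤ Ω) :=
    fun d Ω hΩ => by simp [graph_mul_le hΩ, CSub.smul_le_iff]
  have hmul : ∀ Ω, c.IsClosed Ω →
      ((a * a⁻¹ * (b * b⁻¹)).graph ≤ Ω ↔ a.graph ≤ Ω ∧ b.graph ≤ Ω) := fun Ω hΩ => by
    rw [graph_mul_le hΩ, hgraph a Ω hΩ, elt_mul, elt_inv, mul_inv_cancel, inv_one, one_smul,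
      hgraph b Ω hΩ]
  have ha := a.compact.isClosed
  refine ⟨fun h => ?_, fun h => ext_of (by simp) fun Ω hΩ => ?_⟩
  · exact ((hmul _ ha).1 ((congrArg graph h).trans_le ((hgraph a _ ha).2 le_rfl))).2
  · rw [hmul Ω hΩ, hgraph a Ω hΩ]
    exact and_iff_left_of_imp h.trans

theorem sigma_iff {a b : MonoidOf c hc} : Sigma a b ↔ a.elt = b.elt := by
  constructor
  · rintro ⟨e, -, h⟩
    simpa using congrArg elt h
  · intro h
    refine ⟨a * a⁻¹ * (b * b⁻¹), idem_mul (idem_mul_inv a) (idem_mul_inv b), ?_⟩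
    refine ext_of (by simp [h]) fun Δ hΔ => ?_
    simp only [graph_mul_le hΔ, elt_mul, elt_inv, graph_inv,
      mul_inv_cancel, inv_one, one_smul, mul_one, CSub.smul_le_iff, inv_inv, smul_smul]
    tauto

theorem isIdempotentElem_iff {a : MonoidOf c hc} : IsIdempotentElem a ↔ a.elt = 1 := by
  refine ⟨fun h => by simpa using congrArg elt h.eq, fun h => ?_⟩
  exact ext_of (by simp [h]) fun Δ hΔ => by simp [graph_mul_le hΔ, h]

theorem isXGenEUnitary (hι : Subgroup.closure (Set.range ι) = ⊤) :
    IsXGenEUnitary (gen c hc) ι (proj c hc) where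
  generates := generates_iff_surjective_wordVal.2 surjective_wordVal_gen
  eUnitary a := by rw [sigma_iff, isIdempotentElem_iff, elt_one]
  image := ⟨surjective_of_closure_eq_top hι (Set.range_subset_iff.2 fun x => ⟨gen c hc x, rfl⟩),
    fun _ _ => sigma_iff.symm⟩
  canonical _ := rfl

theorem wordClosed_of_isClosed (hΔ : c.IsClosed Δ) : WordClosed (gen c hc) Δ :=
  fun u v huv g _ k _ => by
    rw [hasPath_iff_graph_wordVal_le hc hΔ, hasPath_iff_graph_wordVal_le hc hΔ, huv]

theorem closure_span_le_of_wordClosed (hΔ : WordClosed (gen c hc) Δ) {g : G} {w : Word X}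
    (hw : CSub.span ι g w ≤ Δ) : c (CSub.span ι g w) ≤ Δ := by
  have hg : g ∈ (c (CSub.span ι g w)).1.verts := (c.le_closure _).1 (Subgr.src_mem_span g w)
  refine (c (CSub.span ι g w)).2.le_of_hasPath hg fun p k hp => ?_
  obtain ⟨hk, hle⟩ := (hasPath_iff_graph_wordVal_le hc (c.isClosed_closure _)).1 hp
  rw [← hc, CSub.smul_span, inv_mul_cancel, ← graph_wordVal (hc := hc)] at hle
  rw [← hk, elt_wordVal]
  exact hΔ.hasPath_of_mul_inv_le (Subgr.span_le.1 hw) (mul_inv_mul_mul_inv_eq_iff.2 hle)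

theorem isClosed_iff_wordClosed (hfin : IsFinitary c) :
    c.IsClosed Δ ↔ WordClosed (gen c hc) Δ := by
  refine ⟨wordClosed_of_isClosed, fun hΔ => hfin.isClosed_of_forall_isFinite fun F hF hFfin => ?_⟩
  obtain ⟨g, hg⟩ := F.2.1
  obtain ⟨w, hw⟩ := F.2.exists_span_eq hFfin hg
  obtain rfl : CSub.span ι g w = F := Subtype.ext hw
  exact closure_span_le_of_wordClosed hΔ hF

theorem eq_closureOf (hfin : IsFinitary c) (h : IsXGenEUnitary (gen c hc) ι (proj c hc)) :
    c = closureOf h :=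
  ClosureOperator.ext_isClosed _ _ fun _ => isClosed_iff_wordClosed hfin

end MonoidOf

section schutzenbergerEquiv

variable {S : Type*} [InverseMonoid S] {ιS : X → S} {φ : S →* G} (h : IsXGenEUnitary ιS ι φ)

/-- The element `(SΓ(s), sσ)` of `S_{c_S}`. -/
def toMonoidOf (s : S) : MonoidOf (closureOf h) (closureOf_invariant h) where
  graph := schutzenberger h s
  elt := φ s
  compact := by
    obtain ⟨w, rfl⟩ := generates_iff_surjective_wordVal.1 h.generates s
    exact ⟨_, Subgr.isFinite_span 1 w, closureOf_span_one h w⟩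
  one_mem := ⟨_, mul_inv_mem_strongComponent h.generates s, map_mul_inv_self φ s⟩
  elt_mem := ⟨s, self_mem_strongComponent ιS s, rfl⟩

theorem toMonoidOf_wordVal (w : Word X) :
    toMonoidOf h (wordVal ιS w) = wordVal (MonoidOf.gen _ (closureOf_invariant h)) w := by
  refine MonoidOf.ext ?_ ?_
  · rw [MonoidOf.graph_wordVal, closureOf_span_one]
    rfl
  · rw [MonoidOf.elt_wordVal]
    exact map_wordVal h.canonical w

theorem toMonoidOf_mul (s t : S) : toMonoidOf h (s * t) = toMonoidOf h s * toMonoidOf h t := by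
  obtain ⟨u, rfl⟩ := generates_iff_surjective_wordVal.1 h.generates s
  obtain ⟨v, rfl⟩ := generates_iff_surjective_wordVal.1 h.generates t
  simp only [← wordVal_append, toMonoidOf_wordVal]

theorem toMonoidOf_bijective : Function.Bijective (toMonoidOf h) := by
  refine ⟨fun s t hst => eq_of_schutzenberger_eq h (congrArg MonoidOf.graph hst)
    (congrArg MonoidOf.elt hst), fun a => ?_⟩
  obtain ⟨w, rfl⟩ := MonoidOf.surjective_wordVal_gen a
  exact ⟨_, toMonoidOf_wordVal h w⟩

/-- The canonical isomorphism `ψ : S → S_{c_S}`, `s ↦ (SΓ(s), sσ)`. -/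
noncomputable def schutzenbergerEquiv : S ≃* MonoidOf (closureOf h) (closureOf_invariant h) :=
  MulEquiv.ofBijective (⟨toMonoidOf h, toMonoidOf_mul h⟩ : _ →ₙ* _) (toMonoidOf_bijective h)

theorem schutzenbergerEquiv_gen (x : X) :
    schutzenbergerEquiv h (ιS x) = MonoidOf.gen _ (closureOf_invariant h) x := by
  simpa [letterVal, schutzenbergerEquiv] using toMonoidOf_wordVal h [(x, true)]

end schutzenbergerEquiv

end XGraph

open XGraph in
theorem mainTheorem3 :
    (∀ {X S G : Type*} [InverseMonoid S] [Group G] (ιS : X → S) (ι : X → G) (φ : S →* G)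
      (h : IsXGenEUnitary ιS ι φ),
      ∃ ψ : S ≃* MonoidOf (closureOf h) (closureOf_invariant h),
        (∀ s, (ψ s).graph = schutzenberger h s ∧ (ψ s).elt = φ s) ∧
        (∀ s, ψ s⁻¹ = (ψ s)⁻¹) ∧
        (∀ x, ψ (ιS x) = MonoidOf.gen (closureOf h) (closureOf_invariant h) x)) ∧
    (∀ {X G : Type*} [Group G] (ι : X → G), Subgroup.closure (Set.range ι) = ⊤ →
      ∀ (c : ClosureOperator (CSub ι)) (hc : IsInvariant c), IsFinitary c →
        ∃ h : IsXGenEUnitary (MonoidOf.gen c hc) ι (MonoidOf.proj c hc),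
          c = closureOf h) := by
  refine ⟨fun ιS ι φ h => ?_, fun ι hι c hc hfin => ?_⟩
  · exact ⟨schutzenbergerEquiv h, fun s => ⟨rfl, rfl⟩,
      InverseMonoid.map_inv_of_mulHomClass (schutzenbergerEquiv h), schutzenbergerEquiv_gen h⟩
  · exact ⟨MonoidOf.isXGenEUnitary hι, MonoidOf.eq_closureOf hfin _⟩
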